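/- For a real random variable $X$ and $h>0$ let $\mathcal Q_h(X)=\sup_{x\in\mathbb R}\mathbb P(X\in(x,x+h])$. For an integer $k\ge 1$ let $\nu^k$ be the uniform distribution on $\{-k+1,-k+3,\ldots,k-1\}$. For $\alpha\in(0,1]$ choose an integer $k\ge1$ with $\frac1{k+1}\le\alpha\le\frac1k$ and let $T(\alpha)$ denote a random variable with law $(1-\tau)\nu^{k+1}+\tau\nu^k$, where $\tau=k(k+1)\alpha-k\in[0,1]$ (when two values of $k$ are possible, they give the same law). Let $n \ge 0$ and $\ell\ge 1$ be integers and let $\alpha_1,\ldots,\alpha_n\in[0,1]$. (i) If $X_1,\ldots,X_n$ are independent real random variables with $\mathcal Q_2(X_i)\le\alpha_i$ for all $i$ (which forces $\alpha_i>0$), and $T_1(\alpha_1),\ldots,T_n(\alpha_n)$ are independent, $T_i(\alpha_i)$ having the law of $T(\alpha_i)$, then $$\mathcal Q_{2\ell}(X_1+\cdots+X_n)\le\mathcal Q_{2\ell}\bigl(T_1(\alpha_1)+\cdots+T_n(\alpha_n)\bigr).$$ (ii) If all $\alpha_i>0$, then such independent $T_i(\alpha_i)$ exist, and any such family satisfies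 $\mathcal Q_2(T_i(\alpha_i))=\alpha_i$ for all $i$ (so that the choice $X_i=T_i(\alpha_i)$ is admissible and attains the bound in (i)) and $$\mathcal Q_{2\ell}\bigl(T_1(\alpha_1)+\cdots+T_n(\alpha_n)\bigr)=\mathbb P\bigl(T_1(\alpha_1)+\cdots+T_n(\alpha_n)\in(-\ell,\ell]\bigr).$$ -/

import Mathlib

open MeasureTheory ProbabilityTheory

noncomputable section

/-- The concentration function `Q_h(X) = sup_x P(X ∈ (x, x + h])` of a real random variable. -/
def concentration {Ω : Type*} [MeasurableSpace Ω] (h : ℝ) (X : Ω → ℝ) (P : Measure Ω) : ℝ :=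
  ⨆ x : ℝ, P.real {ω | X ω ∈ Set.Ioc x (x + h)}

/-- `ν^k`: the uniform distribution on the `k`-term progression `{-k+1, -k+3, …, k-1}`. -/
def uniformAP (k : ℕ) : Measure ℝ :=
  (k : ENNReal)⁻¹ • ∑ j ∈ Finset.range k, Measure.dirac (-(k : ℝ) + 1 + 2 * (j : ℝ))

/-- The mixture `(1 - τ) ν^{k+1} + τ ν^k` with `τ = k (k + 1) α - k`. -/
def mixtureAP (k : ℕ) (α : ℝ) : Measure ℝ :=
  ENNReal.ofReal (1 - ((k : ℝ) * ((k : ℝ) + 1) * α - (k : ℝ))) • uniformAP (k + 1)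
    + ENNReal.ofReal ((k : ℝ) * ((k : ℝ) + 1) * α - (k : ℝ)) • uniformAP k

/-- The law of `T(α)`, for `0 < α ≤ 1`. Here `k = ⌊1/α⌋`, so that `1/(k+1) < α ≤ 1/k`;
`extremalLaw_eq` shows that any `k ≥ 1` with `1/(k+1) ≤ α ≤ 1/k` gives the same law. -/
def extremalLaw (α : ℝ) : Measure ℝ := mixtureAP ⌊1 / α⌋₊ α

theorem extremalLaw_eq (k : ℕ) (hk : 1 ≤ k) (α : ℝ)
    (hα : α ∈ Set.Icc (1 / ((k : ℝ) + 1)) (1 / (k : ℝ))) :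
    extremalLaw α = mixtureAP k α := by
  have hk0 : (0 : ℝ) < k := by exact_mod_cast hk
  have hk1 : (0 : ℝ) < (k : ℝ) + 1 := by linarith
  have hpos : 0 < α := lt_of_lt_of_le (by positivity) hα.1
  rcases eq_or_lt_of_le hα.1 with h | h
  · have hfl : ⌊1 / α⌋₊ = k + 1 := by
      rw [← h, one_div_one_div]
      exact_mod_cast Nat.floor_natCast (R := ℝ) (k + 1)
    have e1 : (k : ℝ) * ((k : ℝ) + 1) * α - (k : ℝ) = 0 := by
      rw [← h]; field_simp; ring
    have e2 : ((k + 1 : ℕ) : ℝ) * (((k + 1 : ℕ) : ℝ) + 1) * α - ((k + 1 : ℕ) : ℝ) = 1 := by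
      rw [← h]; push_cast; field_simp; ring
    rw [extremalLaw, hfl, mixtureAP, mixtureAP, e1, e2]
    simp
  · have hfl : ⌊1 / α⌋₊ = k := by
      rw [Nat.floor_eq_iff (by positivity)]
      constructor
      · rw [le_div_iff₀ hpos]
        have := (le_div_iff₀ hk0).1 hα.2
        linarith
      · rw [div_lt_iff₀ hpos]
        have := (div_lt_iff₀ hk1).1 h
        linarith
    rw [extremalLaw, hfl]

end

/-!
The law of a variable with `Q_2 ≤ α` is a mixture of uniform laws on finite sets whose points are
`2` apart, and the sizes of these sets depend on `α` only. Write the variable as `q(u)`, with `q`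
its quantile function and `u` uniform on `(0, 1)`. Condition on the residue of `u` modulo `α`: then
`u` is uniform on `v, v + α, v + 2 α, …`, which has `k + 1` points below `1` if `v < 1 - k α` and
`k` points otherwise, where `k = ⌊1 / α⌋`. Since `Q_2 ≤ α`, a step of `α` in `u` moves `q(u)` by
at least `2` (`quantile_add_two_le`). The law of `T(α)` is the same mixture of centred
progressions (`lintegral_extremalLaw`).

It remains to see that, among finite `2`-separated sequences of given sizes, the centred
progressions put the largest number of sums into an interval of length `2 ℓ`. The grid of sums of
two `2`-separated sequences of sizes `m` and `k` splits into `2`-separated hooks of sizes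
`m + k - 1, m + k - 3, …`; for centred progressions the hooks are centred progressions
(`sum_grid_le`). So several summands reduce to a single one, for which at most `min k ℓ` terms fit
into a half-open interval of length `2 ℓ`, and the centred progression has that many in
`(-ℓ, ℓ]`.

Both reductions are combined in `sum_lintegral_shift_le`, which adds one variable to the sum, and
`sum_shiftedSumMass_le` iterates it.
-/

/-! ### Separated sequences and their sums -/

/-- The first `k` terms of the sequence `c` increase by steps of at least `2`. The later terms
are irrelevant. -/
def TwoSeparated (k : ℕ) (c : ℕ → ℝ) : Prop := ∀ i, i + 1 < k → c i + 2 ≤ c (i + 1)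

/-- The `j`-th term of the `k`-term progression `-k + 1, -k + 3, …, k - 1`. -/
noncomputable def centeredAP (k j : ℕ) : ℝ := -(k : ℝ) + 1 + 2 * (j : ℝ)

theorem twoSeparated_centeredAP (k : ℕ) : TwoSeparated k (centeredAP k) := by
  intro i _
  simp only [centeredAP]
  push_cast
  linarith

theorem TwoSeparated.add_two_mul_le {k : ℕ} {c : ℕ → ℝ} (hc : TwoSeparated k c) (i d : ℕ)
    (h : i + d < k) : c i + 2 * d ≤ c (i + d) := by
  induction d with
  | zero => simp
  | succ d ih =>
    have h1 := ih (by omega)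
    have h2 := hc (i + d) (by omega)
    rw [← add_assoc]
    push_cast
    linarith

theorem TwoSeparated.card_filter_le {k : ℕ} {c : ℕ → ℝ} (hc : TwoSeparated k c) (ℓ : ℕ) (x : ℝ) :
    ((Finset.range k).filter fun j => c j ∈ Set.Ioc x (x + 2 * (ℓ : ℝ))).card ≤ min k ℓ := by
  refine le_min ((Finset.card_filter_le _ _).trans_eq (Finset.card_range k)) ?_
  set A := (Finset.range k).filter fun j => c j ∈ Set.Ioc x (x + 2 * (ℓ : ℝ)) with hA
  rcases A.eq_empty_or_nonempty with h | h
  · simp [h]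
  have hsub : A ⊆ Finset.Ico (A.min' h) (A.min' h + ℓ) := by
    intro j hj
    have hle := A.min'_le j hj
    refine Finset.mem_Ico.2 ⟨hle, ?_⟩
    obtain ⟨d, hd⟩ := Nat.exists_eq_add_of_le hle
    have hmem : ∀ i ∈ A, i < k ∧ c i ∈ Set.Ioc x (x + 2 * (ℓ : ℝ)) := fun i hi => by
      simpa [hA] using hi
    replace hj := hmem j hj
    have hm := hmem _ (A.min'_mem h)
    have h1 := hc.add_two_mul_le (A.min' h) d (by omega)
    rw [← hd] at h1
    have h2 : (d : ℝ) < ℓ := by linarith [hj.2.2, hm.2.1]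
    have h3 : d < ℓ := by exact_mod_cast h2
    omega
  simpa using Finset.card_le_card hsub

theorem le_card_filter_centeredAP (k ℓ : ℕ) :
    min k ℓ ≤ ((Finset.range k).filter
      fun j => centeredAP k j ∈ Set.Ioc (-(ℓ : ℝ)) (ℓ : ℝ)).card := by
  -- the terms that lie in `(-ℓ, ℓ]` start at the index `⌈(k - ℓ) / 2⌉`, with truncated subtraction
  have hsub : Finset.Ico ((k - ℓ + 1) / 2) ((k - ℓ + 1) / 2 + min k ℓ) ⊆ (Finset.range k).filter
      fun j => centeredAP k j ∈ Set.Ioc (-(ℓ : ℝ)) (ℓ : ℝ) := by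
    intro j hj
    rw [Finset.mem_Ico] at hj
    have h1 : k < ℓ + 1 + 2 * j := by omega
    have h2 : 1 + 2 * j ≤ ℓ + k := by omega
    have h3 : (k : ℝ) < ℓ + 1 + 2 * j := by exact_mod_cast h1
    have h4 : (1 + 2 * j : ℝ) ≤ ℓ + k := by exact_mod_cast h2
    rw [Finset.mem_filter, Finset.mem_range]
    refine ⟨by omega, ?_, ?_⟩ <;> simp only [centeredAP] <;> linarith
  simpa using Finset.card_le_card hsub

/-- The grid of the sums of two `2`-separated sequences splits into `2`-separated hooks. Peeling
off one hook at a time, a comparison with centred progressions passes from single sequences to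
grids, since the hooks of two centred progressions are again centred progressions. -/
theorem sum_grid_le {F G : ℝ → ENNReal}
    (h : ∀ (k : ℕ) (c : ℕ → ℝ), TwoSeparated k c →
      ∑ j ∈ Finset.range k, F (c j) ≤ ∑ j ∈ Finset.range k, G (centeredAP k j))
    (m k : ℕ) (c d : ℕ → ℝ) (hc : TwoSeparated m c) (hd : TwoSeparated k d) :
    ∑ i ∈ Finset.range m, ∑ j ∈ Finset.range k, F (c i + d j)
      ≤ ∑ i ∈ Finset.range m, ∑ j ∈ Finset.range k, G (centeredAP m i + centeredAP k j) := by
  -- the hook is the edge `j = 0` of the grid followed by the edge `i = m`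
  have hook : ∀ (H : ℝ → ENNReal) (m k : ℕ) (c d : ℕ → ℝ),
      ∑ i ∈ Finset.range (m + 1), ∑ j ∈ Finset.range (k + 1), H (c i + d j)
        = ∑ t ∈ Finset.range (m + 1 + k), H (if t < m + 1 then c t + d 0 else c m + d (t - m))
          + ∑ i ∈ Finset.range m, ∑ j ∈ Finset.range k, H (c i + d (j + 1)) := by
    intro H m k c d
    have h1 : ∑ t ∈ Finset.range (m + 1), H (if t < m + 1 then c t + d 0 else c m + d (t - m))
        = ∑ t ∈ Finset.range (m + 1), H (c t + d 0) :=
      Finset.sum_congr rfl fun t ht => by rw [if_pos (Finset.mem_range.1 ht)]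
    have h2 : ∑ s ∈ Finset.range k, H (if m + 1 + s < m + 1 then c (m + 1 + s) + d 0
          else c m + d (m + 1 + s - m)) = ∑ s ∈ Finset.range k, H (c m + d (s + 1)) :=
      Finset.sum_congr rfl fun s _ => by
        rw [if_neg (by omega), show m + 1 + s - m = s + 1 by omega]
    rw [Finset.sum_range_add _ (m + 1) k, h1, h2]
    simp_rw [Finset.sum_range_succ' _ k]
    rw [Finset.sum_add_distrib, Finset.sum_range_succ
      (fun i => ∑ j ∈ Finset.range k, H (c i + d (j + 1)))]
    ring
  induction m generalizing k c d with
  | zero => simp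
  | succ m ih =>
    cases k with
    | zero => simp
    | succ k =>
      rw [hook F, hook G]
      refine add_le_add ?_ ?_
      · refine (h (m + 1 + k) _ ?_).trans_eq (Finset.sum_congr rfl fun t ht => ?_)
        · intro t ht
          beta_reduce
          rcases lt_trichotomy t m with htm | rfl | htm
          · rw [if_pos (by omega), if_pos (by omega)]
            linarith [hc t (by omega)]
          · rw [if_pos (by omega), if_neg (by omega), show t + 1 - t = 0 + 1 by omega]
            linarith [hd 0 (by omega)]
          · rw [if_neg (by omega), if_neg (by omega), show t + 1 - m = t - m + 1 by omega]
            linarith [hd (t - m) (by omega)]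
        · congr 1
          split_ifs with htm
          · simp only [centeredAP]
            push_cast
            ring
          · simp only [centeredAP]
            rw [Nat.cast_sub (by omega)]
            push_cast
            ring
      · refine (ih k c (fun j => d (j + 1)) (fun i hi => hc i (by omega))
          (fun j hj => hd (j + 1) (by omega))).trans_eq ?_
        refine Finset.sum_congr rfl fun i _ => Finset.sum_congr rfl fun j _ => ?_
        congr 1
        simp only [centeredAP]
        push_cast
        ring

/-! ### Quantile functions -/

/-- The quantile function `u ↦ inf {x | u ≤ F x}` of a law with distribution function `F`,
meaningful for `0 < u < 1`. -/
noncomputable def quantile (μ : Measure ℝ) (u : ℝ) : ℝ := sInf {x | u ≤ cdf μ x}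

theorem quantile_le_iff (μ : Measure ℝ) {u : ℝ} (hu : u ∈ Set.Ioo (0 : ℝ) 1) (x : ℝ) :
    quantile μ u ≤ x ↔ u ≤ cdf μ x := by
  have hne : {x | u ≤ cdf μ x}.Nonempty :=
    (((tendsto_cdf_atTop μ).eventually (lt_mem_nhds hu.2)).exists).imp fun _ h => le_of_lt h
  have hbdd : BddBelow {x | u ≤ cdf μ x} := by
    obtain ⟨y, hy⟩ := ((tendsto_cdf_atBot μ).eventually (gt_mem_nhds hu.1)).exists
    exact ⟨y, fun z hz => le_of_not_gt fun hzy =>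
      absurd (hz.trans (monotone_cdf μ hzy.le)) (not_le.2 hy)⟩
  refine ⟨fun h => ?_, fun h => csInf_le hbdd h⟩
  -- right continuity of the distribution function makes the infimum a minimum
  refine ge_of_tendsto (((cdf μ).right_continuous x).tendsto.mono_left
    (nhdsWithin_mono x Set.Ioi_subset_Ici_self)) ?_
  filter_upwards [self_mem_nhdsWithin] with y hy
  obtain ⟨z, hz, hzy⟩ := exists_lt_of_csInf_lt hne (lt_of_le_of_lt h hy)
  exact le_trans hz (monotone_cdf μ hzy.le)

theorem monotoneOn_quantile (μ : Measure ℝ) : MonotoneOn (quantile μ) (Set.Ioo 0 1) :=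
  fun _ hu _ hv huv => (quantile_le_iff μ hu _).2 (huv.trans ((quantile_le_iff μ hv _).1 le_rfl))

theorem aemeasurable_quantile (μ : Measure ℝ) :
    AEMeasurable (quantile μ) (volume.restrict (Set.Ioo 0 1)) :=
  aemeasurable_restrict_of_monotoneOn measurableSet_Ioo (monotoneOn_quantile μ)

theorem map_quantile (μ : Measure ℝ) [IsProbabilityMeasure μ] :
    (volume.restrict (Set.Ioo (0 : ℝ) 1)).map (quantile μ) = μ := by
  have : IsProbabilityMeasure (volume.restrict (Set.Ioo (0 : ℝ) 1)) := ⟨by simp⟩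
  have := Measure.isProbabilityMeasure_map (aemeasurable_quantile μ)
  refine Measure.ext_of_Iic _ _ fun x => ?_
  rw [Measure.map_apply_of_aemeasurable (aemeasurable_quantile μ) measurableSet_Iic,
    Measure.restrict_apply₀' measurableSet_Ioo.nullMeasurableSet, ← ofReal_cdf]
  have h : quantile μ ⁻¹' Set.Iic x ∩ Set.Ioo 0 1 = Set.Iic (cdf μ x) ∩ Set.Ioo 0 1 := by
    ext u
    exact and_congr_left fun hu => quantile_le_iff μ hu x
  rw [h]
  have h0 := cdf_nonneg μ x
  have h1 := cdf_le_one μ x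
  refine le_antisymm ?_ ?_
  · refine (measure_mono (t := Set.Ioc 0 (cdf μ x)) fun u hu => ⟨hu.2.1, hu.1⟩).trans_eq ?_
    simp
  · refine le_trans (by simp) (measure_mono (s := Set.Ioo 0 (cdf μ x)) fun u hu =>
      ⟨hu.2.le, hu.1, hu.2.trans_le h1⟩)

/-- If every half-open interval of length `2` has mass at most `α`, then a step of `α` in the
argument of the quantile function is a step of at least `2` in its value. -/
theorem quantile_add_two_le (μ : Measure ℝ) [IsProbabilityMeasure μ] {α : ℝ}
    (hμ : ∀ x, μ.real (Set.Ioc x (x + 2)) ≤ α) {u : ℝ} (hu : u ∈ Set.Ioo (0 : ℝ) 1)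
    (hv : u + α ∈ Set.Ioo (0 : ℝ) 1) : quantile μ u + 2 ≤ quantile μ (u + α) := by
  refine le_of_forall_lt fun y hy => ?_
  have h1 : cdf μ (y - 2) < u := by
    rw [← not_le, ← quantile_le_iff μ hu, not_le]
    linarith
  have h2 : cdf μ y ≤ cdf μ (y - 2) + α := by
    have h3 := hμ (y - 2)
    have h4 := measureReal_union_le (μ := μ) (Set.Iic (y - 2)) (Set.Ioc (y - 2) (y - 2 + 2))
    rw [Set.Iic_union_Ioc_eq_Iic (by linarith), sub_add_cancel] at h4
    rw [sub_add_cancel] at h3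
    rw [cdf_eq_real, cdf_eq_real]
    linarith
  rw [← not_le, quantile_le_iff μ hv, not_le]
  linarith

theorem lintegral_Ioc_add (h : ℝ → ENNReal) (a b c : ℝ) :
    ∫⁻ u in Set.Ioc (a + c) (b + c), h u = ∫⁻ v in Set.Ioc a b, h (v + c) := by
  rw [← (measurePreserving_add_right (volume : Measure ℝ) c).setLIntegral_comp_preimage_emb
    (measurableEmbedding_addRight c)]
  simp

theorem lintegral_Ioc_append (h : ℝ → ENNReal) {a b c : ℝ} (hab : a ≤ b) (hbc : b ≤ c) :
    ∫⁻ u in Set.Ioc a c, h u = (∫⁻ u in Set.Ioc a b, h u) + ∫⁻ u in Set.Ioc b c, h u := by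
  rw [← Set.Ioc_union_Ioc_eq_Ioc hab hbc, lintegral_union measurableSet_Ioc]
  exact Set.Ioc_disjoint_Ioc_of_le (le_refl b)

theorem lintegral_Ioc_mul (h : ℝ → ENNReal) {α : ℝ} (hα : 0 ≤ α) (k : ℕ) :
    ∫⁻ u in Set.Ioc 0 (k * α), h u
      = ∑ j ∈ Finset.range k, ∫⁻ v in Set.Ioc 0 α, h (v + j * α) := by
  induction k with
  | zero => simp
  | succ k ih =>
    have hk : (0 : ℝ) ≤ k * α := by positivity
    rw [Finset.sum_range_succ, ← ih, ← lintegral_Ioc_add, zero_add,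
      lintegral_Ioc_append h hk (c := ((k + 1 : ℕ) : ℝ) * α) (by push_cast; linarith)]
    congr 3
    push_cast
    ring_nf

/-- The points of `(0, 1]` are grouped by their residue `v ∈ (0, α]` modulo `α`: a residue
`v ≤ 1 - k α` has `k + 1` representatives and any other one has `k`. -/
theorem lintegral_Ioc_zero_one (h : ℝ → ENNReal) {α : ℝ} (hα : 0 ≤ α) (k : ℕ) (h1 : k * α ≤ 1)
    (h2 : 1 ≤ (k + 1) * α) :
    ∫⁻ u in Set.Ioc 0 1, h u
      = (∑ j ∈ Finset.range (k + 1), ∫⁻ v in Set.Ioc 0 (1 - k * α), h (v + j * α))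
        + ∑ j ∈ Finset.range k, ∫⁻ v in Set.Ioc (1 - k * α) α, h (v + j * α) := by
  have hk : (0 : ℝ) ≤ k * α := by positivity
  have h3 : Set.Ioc ((k : ℝ) * α) 1 = Set.Ioc (0 + (k : ℝ) * α) (1 - k * α + k * α) := by
    simp
  rw [lintegral_Ioc_append h hk h1, lintegral_Ioc_mul h hα, h3, lintegral_Ioc_add,
    Finset.sum_congr rfl fun (j : ℕ) _ => lintegral_Ioc_append (fun v => h (v + j * α))
      (sub_nonneg.2 h1) (show 1 - k * α ≤ α by linarith),
    Finset.sum_add_distrib, Finset.sum_range_succ]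
  ring

/-! ### Splitting a law into separated sequences -/

theorem lintegral_uniformAP (g : ℝ → ENNReal) (k : ℕ) :
    ∫⁻ z, g z ∂(uniformAP k) = (k : ENNReal)⁻¹ * ∑ j ∈ Finset.range k, g (centeredAP k j) := by
  simp [uniformAP, centeredAP, lintegral_smul_measure]

theorem floor_one_div_spec {α : ℝ} (h0 : 0 < α) (h1 : α ≤ 1) :
    1 ≤ ⌊1 / α⌋₊ ∧ (⌊1 / α⌋₊ : ℝ) * α ≤ 1 ∧ 1 ≤ ((⌊1 / α⌋₊ : ℝ) + 1) * α := by
  refine ⟨?_, ?_, ?_⟩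
  · rw [Nat.one_le_floor_iff, le_div_iff₀ h0]
    linarith
  · rw [← le_div_iff₀ h0]
    exact Nat.floor_le (by positivity)
  · rw [← div_le_iff₀ h0]
    exact (Nat.lt_floor_add_one _).le

/-- Each of the `k + 1` atoms of the wider progression has mass `1 - k α`, and each of the `k`
atoms of the narrower one has mass `(k + 1) α - 1 = α - (1 - k α)`. -/
theorem lintegral_extremalLaw (g : ℝ → ENNReal) {α : ℝ} (h0 : 0 < α) (h1 : α ≤ 1) {k : ℕ}
    (hk : k = ⌊1 / α⌋₊) :
    ∫⁻ z, g z ∂(extremalLaw α)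
      = ENNReal.ofReal (1 - k * α) * ∑ j ∈ Finset.range (k + 1), g (centeredAP (k + 1) j)
        + ENNReal.ofReal (α - (1 - k * α)) * ∑ j ∈ Finset.range k, g (centeredAP k j) := by
  obtain ⟨hk1, -, -⟩ := floor_one_div_spec h0 h1
  rw [← hk] at hk1
  have hk0 : (0 : ℝ) < k := by exact_mod_cast hk1
  have e1 : ENNReal.ofReal (1 - (k * (k + 1) * α - k)) * ((k + 1 : ℕ) : ENNReal)⁻¹
      = ENNReal.ofReal (1 - k * α) := by
    rw [← ENNReal.ofReal_natCast, ← ENNReal.ofReal_inv_of_pos (by positivity),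
      ← ENNReal.ofReal_mul' (by positivity)]
    congr 1
    push_cast
    field_simp
    ring
  have e2 : ENNReal.ofReal (k * (k + 1) * α - k) * (k : ENNReal)⁻¹
      = ENNReal.ofReal (α - (1 - k * α)) := by
    rw [← ENNReal.ofReal_natCast, ← ENNReal.ofReal_inv_of_pos hk0,
      ← ENNReal.ofReal_mul' (by positivity)]
    congr 1
    field_simp
    ring
  rw [extremalLaw, ← hk, mixtureAP, lintegral_add_measure, lintegral_smul_measure,
    lintegral_smul_measure, lintegral_uniformAP, lintegral_uniformAP, smul_eq_mul, smul_eq_mul,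
    ← mul_assoc, ← mul_assoc, e1, e2]

theorem isProbabilityMeasure_extremalLaw {α : ℝ} (h0 : 0 < α) (h1 : α ≤ 1) :
    IsProbabilityMeasure (extremalLaw α) := by
  obtain ⟨hk1, hk2, hk3⟩ := floor_one_div_spec h0 h1
  refine ⟨?_⟩
  have h := lintegral_extremalLaw (fun _ => 1) h0 h1 rfl
  rw [lintegral_one] at h
  rw [h]
  simp only [Finset.sum_const, Finset.card_range, nsmul_eq_mul, mul_one]
  rw [← ENNReal.ofReal_natCast, ← ENNReal.ofReal_natCast, ← ENNReal.ofReal_mul' (by positivity),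
    ← ENNReal.ofReal_mul' (by positivity), ← ENNReal.ofReal_add, ENNReal.ofReal_eq_one]
  · push_cast
    ring
  · exact mul_nonneg (by linarith) (by positivity)
  · exact mul_nonneg (by linarith) (by positivity)

/-- A half-open interval of length `2` contains at most one atom of either progression. -/
theorem extremalLaw_Ioc_le {α : ℝ} (h0 : 0 < α) (h1 : α ≤ 1) (x : ℝ) :
    extremalLaw α (Set.Ioc x (x + 2)) ≤ ENNReal.ofReal α := by
  obtain ⟨hk1, hk2, hk3⟩ := floor_one_div_spec h0 h1
  have key : ∀ k : ℕ, ∑ j ∈ Finset.range k,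
      (Set.Ioc x (x + 2)).indicator (1 : ℝ → ENNReal) (centeredAP k j) ≤ 1 := by
    intro k
    have h := (twoSeparated_centeredAP k).card_filter_le 1 x
    simp only [Set.indicator_apply, Pi.one_apply, Finset.sum_boole]
    rw [Nat.cast_one, mul_one] at h
    exact_mod_cast h.trans (min_le_right _ _)
  rw [← lintegral_indicator_one measurableSet_Ioc, lintegral_extremalLaw _ h0 h1 rfl]
  refine (add_le_add (mul_le_of_le_one_right' (key _)) (mul_le_of_le_one_right' (key _))).trans_eq ?_
  rw [← ENNReal.ofReal_add (by linarith) (by linarith)]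
  congr 1
  ring

/-- The interval `(-1, 1]` contains one atom of either progression: `0` and `1`, in an order that
depends on the parity of `k`. -/
theorem le_extremalLaw_Ioc {α : ℝ} (h0 : 0 < α) (h1 : α ≤ 1) :
    ENNReal.ofReal α ≤ extremalLaw α (Set.Ioc (-1) 1) := by
  obtain ⟨hk1, hk2, hk3⟩ := floor_one_div_spec h0 h1
  have key : ∀ k : ℕ, 1 ≤ k → 1 ≤ ∑ j ∈ Finset.range k,
      (Set.Ioc (-1) 1).indicator (1 : ℝ → ENNReal) (centeredAP k j) := by
    intro k hk
    have h := le_card_filter_centeredAP k 1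
    simp only [Set.indicator_apply, Pi.one_apply, Finset.sum_boole]
    rw [Nat.cast_one, min_eq_right hk] at h
    exact_mod_cast h
  rw [← lintegral_indicator_one measurableSet_Ioc, lintegral_extremalLaw _ h0 h1 rfl]
  refine le_trans (le_of_eq ?_) (add_le_add (le_mul_of_one_le_right' (key _ (by omega)))
    (le_mul_of_one_le_right' (key _ hk1)))
  rw [← ENNReal.ofReal_add (by linarith) (by linarith)]
  congr 1
  ring

/-- Superadditivity of the lower integral needs no measurability, so none has to be checked when the
conditional averages over the residues are collected under one integral. -/
theorem sum_lintegral_le {X ι : Type*} [MeasurableSpace X] (ρ : Measure X) (s : Finset ι)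
    (f : ι → X → ENNReal) : ∑ i ∈ s, ∫⁻ x, f i x ∂ρ ≤ ∫⁻ x, ∑ i ∈ s, f i x ∂ρ := by
  classical
  induction s using Finset.induction_on with
  | empty => simp
  | insert i s hi ih =>
    simp_rw [Finset.sum_insert hi]
    exact (add_le_add le_rfl ih).trans (le_lintegral_add _ _)

/-- The comparison of a function with another one along `2`-separated sequences survives the
replacement of both by their averages over shifts, one shift having concentration at most `α` and
the other one the law of `T(α)`. The first shift is `q(u)` with `u` uniform on `(0, 1)` and `q` its
quantile function; given the residue of `u` modulo `α`, it is uniform on a `2`-separated sequence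
of `k + 1` or `k` points, just as the second shift is for a centred progression. -/
theorem sum_lintegral_shift_le {F G : ℝ → ENNReal} (hF : Measurable F)
    (h : ∀ (k : ℕ) (c : ℕ → ℝ), TwoSeparated k c →
      ∑ j ∈ Finset.range k, F (c j) ≤ ∑ j ∈ Finset.range k, G (centeredAP k j))
    (μ : Measure ℝ) [IsProbabilityMeasure μ] {α : ℝ} (h0 : 0 < α) (h1 : α ≤ 1)
    (hμ : ∀ x, μ.real (Set.Ioc x (x + 2)) ≤ α) (m : ℕ) (c : ℕ → ℝ) (hc : TwoSeparated m c) :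
    ∑ i ∈ Finset.range m, ∫⁻ z, F (c i + z) ∂μ
      ≤ ∑ i ∈ Finset.range m, ∫⁻ z, G (centeredAP m i + z) ∂(extremalLaw α) := by
  obtain ⟨hk1, hk2, hk3⟩ := floor_one_div_spec h0 h1
  obtain ⟨k, hk⟩ : ∃ k, k = ⌊1 / α⌋₊ := ⟨_, rfl⟩
  rw [← hk] at hk1 hk2 hk3
  -- open intervals, because `quantile_add_two_le` needs arguments strictly between `0` and `1`
  have split : ∀ i, ∫⁻ z, F (c i + z) ∂μ
      = (∑ j ∈ Finset.range (k + 1),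
          ∫⁻ v in Set.Ioo 0 (1 - k * α), F (c i + quantile μ (v + j * α)))
        + ∑ j ∈ Finset.range k,
          ∫⁻ v in Set.Ioo (1 - k * α) α, F (c i + quantile μ (v + j * α)) := by
    intro i
    have hFi : Measurable fun z => F (c i + z) := hF.comp (measurable_const_add (c i))
    conv_lhs => rw [← map_quantile μ]
    rw [lintegral_map' hFi.aemeasurable (aemeasurable_quantile μ),
      setLIntegral_congr Ioo_ae_eq_Ioc,
      lintegral_Ioc_zero_one (fun u => F (c i + quantile μ u)) h0.le k hk2 hk3]
    simp_rw [setLIntegral_congr (Ioo_ae_eq_Ioc (μ := volume))]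
  -- a bound for all the offsets `v` in an interval, from the bound for a single one
  have part : ∀ (r : ℕ) (a b : ℝ), 0 ≤ a → (∀ v ∈ Set.Ioo a b, ∀ j < r, v + j * α < 1) →
      ∑ i ∈ Finset.range m, ∑ j ∈ Finset.range r,
          ∫⁻ v in Set.Ioo a b, F (c i + quantile μ (v + j * α))
        ≤ ENNReal.ofReal (b - a) * ∑ i ∈ Finset.range m, ∑ j ∈ Finset.range r,
          G (centeredAP m i + centeredAP r j) := by
    intro r a b ha hr
    refine (Finset.sum_le_sum fun i _ => sum_lintegral_le _ _ _).trans
      ((sum_lintegral_le _ _ _).trans ?_)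
    rw [← Real.volume_Ioo, mul_comm, ← setLIntegral_const]
    refine setLIntegral_mono' measurableSet_Ioo fun v hv => ?_
    refine sum_grid_le h m r c (fun j => quantile μ (v + j * α)) hc fun j hj => ?_
    have hmem : ∀ j < r, v + j * α ∈ Set.Ioo (0 : ℝ) 1 := fun j hj =>
      ⟨add_pos_of_pos_of_nonneg (ha.trans_lt hv.1) (by positivity), hr v hv j hj⟩
    have e : v + ((j + 1 : ℕ) : ℝ) * α = v + j * α + α := by
      push_cast
      ring
    beta_reduce
    rw [e]
    exact quantile_add_two_le μ hμ (hmem j (by omega)) (e ▸ hmem (j + 1) hj)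
  simp_rw [split, lintegral_extremalLaw _ h0 h1 hk, Finset.sum_add_distrib, ← Finset.mul_sum]
  refine add_le_add ((part (k + 1) 0 (1 - k * α) le_rfl ?_).trans_eq (by rw [sub_zero]))
    (part k (1 - k * α) α (by linarith) ?_)
  · intro v hv j hj
    have h2 : (j : ℝ) ≤ k := by exact_mod_cast Nat.lt_succ_iff.1 hj
    nlinarith [hv.2]
  · intro v hv j hj
    have h2 : (j : ℝ) + 1 ≤ k := by exact_mod_cast hj
    nlinarith [hv.2]

/-! ### Sums of independent variables -/

/-- The probability that `z` plus the sum of independent variables with laws `μ i` lies in `E`. -/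
noncomputable def shiftedSumMass {n : ℕ} (μ : Fin n → Measure ℝ) (E : Set ℝ) (z : ℝ) : ENNReal :=
  Measure.pi μ {v | z + ∑ i, v i ∈ E}

theorem measurable_shiftedSumMass {n : ℕ} (μ : Fin n → Measure ℝ)
    [∀ i, IsProbabilityMeasure (μ i)] {E : Set ℝ} (hE : MeasurableSet E) :
    Measurable (shiftedSumMass μ E) := by
  have hm : Measurable fun p : ℝ × (Fin n → ℝ) => p.1 + ∑ i, p.2 i := by fun_prop
  exact measurable_measure_prodMk_left (hm hE)

theorem shiftedSumMass_succ {n : ℕ} (μ : Fin (n + 1) → Measure ℝ)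
    [∀ i, IsProbabilityMeasure (μ i)] {E : Set ℝ} (hE : MeasurableSet E) (z : ℝ) :
    shiftedSumMass μ E z = ∫⁻ w, shiftedSumMass (fun i => μ i.succ) E (z + w) ∂(μ 0) := by
  have hm : Measurable fun p : ℝ × (Fin n → ℝ) => z + (p.1 + ∑ i, p.2 i) := by fun_prop
  have h := (measurePreserving_piFinSuccAbove μ 0).measure_preimage (hm hE).nullMeasurableSet
  rw [Measure.prod_apply (hm hE)] at h
  simp only [Fin.zero_succAbove] at h
  simp only [shiftedSumMass, Fin.sum_univ_succ, add_assoc]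
  exact h

/-- The comparison behind the bound, in a form that passes from `n` to `n + 1` variables: besides
the `n` random summands there is one that runs through a deterministic `2`-separated sequence. -/
theorem sum_shiftedSumMass_le {n : ℕ} (ℓ : ℕ) (x : ℝ) (μ : Fin n → Measure ℝ)
    [∀ i, IsProbabilityMeasure (μ i)] (α : Fin n → ℝ) (h0 : ∀ i, 0 < α i) (h1 : ∀ i, α i ≤ 1)
    (hμ : ∀ i x, (μ i).real (Set.Ioc x (x + 2)) ≤ α i) (m : ℕ) (c : ℕ → ℝ)
    (hc : TwoSeparated m c) :
    ∑ j ∈ Finset.range m, shiftedSumMass μ (Set.Ioc x (x + 2 * (ℓ : ℝ))) (c j)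
      ≤ ∑ j ∈ Finset.range m,
        shiftedSumMass (fun i => extremalLaw (α i)) (Set.Ioc (-(ℓ : ℝ)) ℓ) (centeredAP m j) := by
  have hT := fun i => isProbabilityMeasure_extremalLaw (h0 i) (h1 i)
  induction n generalizing m c with
  | zero =>
    have hd : ∀ (ν : Fin 0 → Measure ℝ) (E : Set ℝ) (z : ℝ),
        shiftedSumMass ν E z = E.indicator 1 z := by
      intro ν E z
      by_cases hz : z ∈ E <;> simp [shiftedSumMass, hz]
    simp only [hd, Set.indicator_apply, Pi.one_apply, Finset.sum_boole]
    exact_mod_cast (hc.card_filter_le ℓ x).trans (le_card_filter_centeredAP m ℓ)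
  | succ n ih =>
    simp_rw [shiftedSumMass_succ _ measurableSet_Ioc]
    exact sum_lintegral_shift_le (measurable_shiftedSumMass _ measurableSet_Ioc)
      (fun k d hd => ih (fun i => μ i.succ) (fun i => α i.succ) (fun i => h0 i.succ)
        (fun i => h1 i.succ) (fun i => hμ i.succ) k d hd fun i => hT i.succ)
      (μ 0) (h0 0) (h1 0) (hμ 0) m c hc

theorem pi_sum_mem_Ioc_le {n : ℕ} (ℓ : ℕ) (x : ℝ) (μ : Fin n → Measure ℝ)
    [∀ i, IsProbabilityMeasure (μ i)] (α : Fin n → ℝ) (h0 : ∀ i, 0 < α i) (h1 : ∀ i, α i ≤ 1)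
    (hμ : ∀ i x, (μ i).real (Set.Ioc x (x + 2)) ≤ α i) :
    Measure.pi μ {v | ∑ i, v i ∈ Set.Ioc x (x + 2 * (ℓ : ℝ))}
      ≤ Measure.pi (fun i => extremalLaw (α i)) {v | ∑ i, v i ∈ Set.Ioc (-(ℓ : ℝ)) ℓ} := by
  have h := sum_shiftedSumMass_le ℓ x μ α h0 h1 hμ 1 (centeredAP 1) (twoSeparated_centeredAP 1)
  simpa [shiftedSumMass, centeredAP] using h

/-! ### Concentration functions -/

section Concentration

variable {Ω : Type*} [MeasurableSpace Ω] {P : Measure Ω} [IsProbabilityMeasure P]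

theorem measureReal_le_concentration (h : ℝ) (X : Ω → ℝ) (x : ℝ) :
    P.real {ω | X ω ∈ Set.Ioc x (x + h)} ≤ concentration h X P :=
  le_ciSup (f := fun x : ℝ => P.real {ω | X ω ∈ Set.Ioc x (x + h)})
    ⟨1, by rintro _ ⟨y, rfl⟩; exact measureReal_le_one⟩ x

theorem measureReal_Ioc_neg_le_concentration (ℓ : ℕ) (X : Ω → ℝ) :
    P.real {ω | X ω ∈ Set.Ioc (-(ℓ : ℝ)) (ℓ : ℝ)} ≤ concentration (2 * (ℓ : ℝ)) X P := by
  have h := measureReal_le_concentration (P := P) (2 * (ℓ : ℝ)) X (-ℓ)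
  rwa [show -(ℓ : ℝ) + 2 * ℓ = ℓ by ring] at h

theorem map_real_Ioc_le {α : ℝ} {X : Ω → ℝ} (hX : AEMeasurable X P)
    (h : concentration 2 X P ≤ α) (x : ℝ) : (P.map X).real (Set.Ioc x (x + 2)) ≤ α := by
  rw [map_measureReal_apply_of_aemeasurable hX measurableSet_Ioc]
  exact (measureReal_le_concentration 2 X x).trans h

/-- Some interval `(2 N, 2 N + 2]` has positive mass, since these intervals cover the line. -/
theorem concentration_two_pos {X : Ω → ℝ} (hX : AEMeasurable X P) : 0 < concentration 2 X P := by
  by_contra hneg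
  have := Measure.isProbabilityMeasure_map hX
  have hz : ∀ N : ℤ, P.map X (Set.Ioc ((N : ℝ) * 2) (N * 2 + 2)) = 0 := fun N =>
    (measureReal_eq_zero_iff).1 (le_antisymm
      (map_real_Ioc_le hX (not_lt.1 hneg) _) measureReal_nonneg)
  have hcover : (⋃ N : ℤ, Set.Ioc ((N : ℝ) * 2) (N * 2 + 2)) = Set.univ := by
    simpa [add_mul] using iUnion_Ioc_zsmul (zero_lt_two (α := ℝ))
  have h1 : P.map X Set.univ = 0 := by
    rw [← hcover]
    exact measure_iUnion_null hz
  simp at h1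

theorem measure_sum_mem {n : ℕ} {X : Fin n → Ω → ℝ} (hX : ∀ i, AEMeasurable (X i) P)
    (hind : iIndepFun X P) {E : Set ℝ} (hE : MeasurableSet E) :
    P {ω | ∑ i, X i ω ∈ E} = Measure.pi (fun i => P.map (X i)) {v | ∑ i, v i ∈ E} := by
  have hm : Measurable fun v : Fin n → ℝ => ∑ i, v i := by fun_prop
  rw [← (iIndepFun_iff_map_fun_eq_pi_map hX).1 hind]
  exact (Measure.map_apply_of_aemeasurable (aemeasurable_pi_lambda _ hX) (hm hE)).symm

end Concentration

/-- The sharp bound, with the probability of the centred interval on the right-hand side. -/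
theorem concentration_sum_le {Ω Ω' : Type*} [MeasurableSpace Ω] [MeasurableSpace Ω']
    {P : Measure Ω} {P' : Measure Ω'} [IsProbabilityMeasure P] [IsProbabilityMeasure P']
    {n : ℕ} (ℓ : ℕ) {α : Fin n → ℝ} (h1 : ∀ i, α i ≤ 1) {X : Fin n → Ω → ℝ}
    {T : Fin n → Ω' → ℝ} (hX : ∀ i, AEMeasurable (X i) P) (hXi : iIndepFun X P)
    (hXα : ∀ i, concentration 2 (X i) P ≤ α i)
    (hT : ∀ i, HasLaw (T i) (extremalLaw (α i)) P') (hTi : iIndepFun T P') :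
    concentration (2 * (ℓ : ℝ)) (fun ω => ∑ i, X i ω) P
      ≤ P'.real {ω | (∑ i, T i ω) ∈ Set.Ioc (-(ℓ : ℝ)) (ℓ : ℝ)} := by
  have h0 : ∀ i, 0 < α i := fun i => (concentration_two_pos (hX i)).trans_le (hXα i)
  have hmap := fun i => Measure.isProbabilityMeasure_map (hX i)
  refine ciSup_le fun x => ?_
  refine ENNReal.toReal_mono (measure_ne_top _ _) ?_
  rw [measure_sum_mem hX hXi measurableSet_Ioc,
    measure_sum_mem (fun i => (hT i).aemeasurable) hTi measurableSet_Ioc]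
  simp_rw [fun i => (hT i).map_eq]
  exact pi_sum_mem_Ioc_le ℓ x _ α h0 h1 fun i => map_real_Ioc_le (hX i) (hXα i)

theorem concentration_of_hasLaw_extremalLaw {Ω : Type*} [MeasurableSpace Ω] {P : Measure Ω}
    [IsProbabilityMeasure P] {α : ℝ} (h0 : 0 < α) (h1 : α ≤ 1) {T : Ω → ℝ}
    (hT : HasLaw T (extremalLaw α) P) : concentration 2 T P = α := by
  have hlaw : ∀ x, P {ω | T ω ∈ Set.Ioc x (x + 2)} = extremalLaw α (Set.Ioc x (x + 2)) :=
    fun x => hT.measure_eq measurableSet_Ioc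
  refine le_antisymm (ciSup_le fun x => ?_) (le_trans ?_ (measureReal_le_concentration 2 T (-1)))
  · rw [measureReal_def, hlaw]
    exact ENNReal.toReal_le_of_le_ofReal h0.le (extremalLaw_Ioc_le h0 h1 x)
  · rw [measureReal_def, ← ENNReal.ofReal_le_iff_le_toReal (measure_ne_top _ _), hlaw]
    norm_num
    exact le_extremalLaw_Ioc h0 h1

theorem theorem2 (n ℓ : ℕ) (hℓ : 1 ≤ ℓ) (α : Fin n → ℝ)
    (hα : ∀ i, α i ∈ Set.Icc (0 : ℝ) 1) :
    -- the inequality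
    (∀ {Ω : Type*} [MeasurableSpace Ω] (P : Measure Ω) [IsProbabilityMeasure P]
        (X : Fin n → Ω → ℝ) {Ω' : Type*} [MeasurableSpace Ω'] (P' : Measure Ω')
        [IsProbabilityMeasure P'] (T : Fin n → Ω' → ℝ),
        (∀ i, Measurable (X i)) → iIndepFun X P →
        (∀ i, concentration 2 (X i) P ≤ α i) →
        (∀ i, HasLaw (T i) (extremalLaw (α i)) P') → iIndepFun T P' →
        concentration (2 * (ℓ : ℝ)) (fun ω => ∑ i, X i ω) P
          ≤ concentration (2 * (ℓ : ℝ)) (fun ω => ∑ i, T i ω) P') ∧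
    -- the extremal variables are admissible, and their optimal interval
    ((∀ i, 0 < α i) →
      ∀ {Ω' : Type*} [MeasurableSpace Ω'] (P' : Measure Ω') [IsProbabilityMeasure P']
        (T : Fin n → Ω' → ℝ),
        (∀ i, HasLaw (T i) (extremalLaw (α i)) P') → iIndepFun T P' →
        (∀ i, concentration 2 (T i) P' = α i) ∧
        concentration (2 * (ℓ : ℝ)) (fun ω => ∑ i, T i ω) P'
          = P'.real {ω | (∑ i, T i ω) ∈ Set.Ioc (-(ℓ : ℝ)) (ℓ : ℝ)}) ∧
    -- independent variables with these laws exist, so the bound is attained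
    ((∀ i, 0 < α i) →
      ∃ (Ω' : Type) (_ : MeasurableSpace Ω') (P' : Measure Ω') (_ : IsProbabilityMeasure P')
        (T : Fin n → Ω' → ℝ),
        (∀ i, Measurable (T i)) ∧ iIndepFun T P' ∧
        (∀ i, HasLaw (T i) (extremalLaw (α i)) P')) := by
  refine ⟨?_, ?_, ?_⟩
  · intro Ω _ P _ X Ω' _ P' _ T hX hXi hXα hT hTi
    refine (concentration_sum_le ℓ (fun i => (hα i).2) (fun i => (hX i).aemeasurable) hXi hXα
      hT hTi).trans (measureReal_Ioc_neg_le_concentration ℓ _)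
  · intro h0 Ω' _ P' _ T hT hTi
    have hc := fun i => concentration_of_hasLaw_extremalLaw (h0 i) (hα i).2 (hT i)
    refine ⟨hc, le_antisymm (concentration_sum_le ℓ (fun i => (hα i).2)
      (fun i => (hT i).aemeasurable) hTi (fun i => (hc i).le) hT hTi)
      (measureReal_Ioc_neg_le_concentration ℓ _)⟩
  · intro h0
    have hp := fun i => isProbabilityMeasure_extremalLaw (h0 i) (hα i).2
    refine ⟨Fin n → ℝ, inferInstance, Measure.pi fun i => extremalLaw (α i), inferInstance,
      fun i v => v i, fun i => measurable_pi_apply i, ?_, fun i => ?_⟩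
    · exact iIndepFun_pi (X := fun _ x => x) fun i => aemeasurable_id
    · exact ⟨(measurable_pi_apply i).aemeasurable,
        (measurePreserving_eval (fun i => extremalLaw (α i)) i).map_eq⟩
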